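/- To eight integer charges $p^0,\dots,p^3,q_0,\dots,q_3$ of an STU black hole associate the three-qubit state $$|\omega\rangle=p^0|000\rangle-p^1|001\rangle-p^2|010\rangle+q_3|011\rangle-p^3|100\rangle+q_2|101\rangle+q_1|110\rangle+q_0|111\rangle ,$$ and put $\Sigma=\sum_{i=0}^3(q_i^2+(p^i)^2)$, $\eta=1/\sqrt{\Sigma}$. The black hole is a *W black hole* if $|\omega\rangle$ is SLOCC equivalent (that is, via $\mathcal A\otimes\mathcal B\otimes\mathcal C$ with $\mathcal A,\mathcal B,\mathcal C$ invertible) to $W=\frac1{\sqrt3}(|001\rangle+|010\rangle+|100\rangle)$; LU equivalence is the same with unitary $\mathcal A,\mathcal B,\mathcal C$. An Acín–Schmidt decomposition (ASD) of a normalized state $|\psi\rangle$ is a state $$\lambda_0|000\rangle+\lambda_1e^{i\varphi}|100\rangle+\lambda_2|101\rangle+\lambda_3|110\rangle+\lambda_4|111\rangle,\qquad \lambda_i\ge 0,\ \sum_i\lambda_i^2=1,\ \varphi\in[0,2\pi),$$ LU equivalent to $|\psi\rangle$. Let $$h_1=(p^0q_3-p^1p^2-p^3q_0-q_2q_1)^2,\quad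 h_2=(p^0q_2-p^1p^3-p^2q_0-q_3q_1)^2,\quad h_3=(p^0q_1-p^2p^3-p^1q_0-q_3q_2)^2 .$$ **Coefficients.** For every W black hole, $h_1h_2h_3\neq0$, and there are real numbers $\rho_0,\rho_1,\rho_2,\rho_3\ge0$ with $\rho_0\rho_2\rho_3\ne0$ and $$\rho_0^2=\frac{\sqrt{h_1h_2h_3}}{h_1},\quad \rho_1^2=\Sigma-\frac{h_2h_3+h_2h_1+h_3h_1}{\sqrt{h_1h_2h_3}},\quad \rho_2^2=\frac{\sqrt{h_1h_2h_3}}{h_3},\quad \rho_3^2=\frac{\sqrt{h_1h_2h_3}}{h_2};$$ equivalently $\rho_i^2=\xi_i\sqrt{h_1h_2h_3}$ with $\xi_0=1/h_1$, $\xi_1=\rho_1^2/\sqrt{h_1h_2h_3}$, $\xi_2=1/h_3$, $\xi_3=1/h_2$. The normalized state $\eta|\omega\rangle$ has ASDs with phase factor $e^{i\varphi}=\delta$ for $\delta=1$ and for $\delta=-1$, and every ASD of $\eta|\omega\rangle$ has $\lambda_4=0$ and $\lambda_i^2=\eta^2\rho_i^2$ for $i=0,1,2,3$. **LU equivalence.**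 For two W black holes, the states $|\omega\rangle,|\omega'\rangle$ are LU equivalent if and only if $\rho_i=\rho_i'$ for $i=0,1,2,3$. The normalized states $\eta|\omega\rangle,\eta'|\omega'\rangle$ are LU equivalent if and only if $\eta\rho_i=\eta'\rho'_i$ for $i=0,1,2,3$, and if and only if they have ASDs that coincide up to the phase $\varphi$. **Families.** Every W black hole belongs to exactly one of the following eight families; each family is nonempty, and each is closed, within the W black holes, under LU equivalence (both of the states $|\omega\rangle$ and of the normalized states). (i) $\rho_1=0$ and: (1) $\rho_0=\rho_2=\rho_3$; (2) $\rho_0=\rho_3\ne\rho_2$, or $\rho_0=\rho_2\neq\rho_3$, or $\rho_2=\rho_3\ne\rho_0$; (3) $\rho_0,\rho_2,\rho_3$ are pairwise distinct. (ii) $\rho_1\ne0$ and: (4) $\rho_0=\rho_1=\rho_2=\rho_3$; (5) $\rho_i=\rho_j=\rho_k\ne\rho_l$ for some $(i,j,k,l)\in\{(0,1,2,3),(0,1,3,2),(0,2,3,1),(1,2,3,0)\}$; (6) $\rho_i=\rho_j$ and $\rho_i\neq\rho_k\ne\rho_l\ne\rho_i$ for some $(i,j,k,l)\in\{(0,1,2,3),(2,3,0,1),(0,2,1,3),(1,3,0,2),(0,3,1,2),(1,2,0,3)\}$;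 (7) $\rho_i=\rho_j\neq\rho_k=\rho_l$ for some $(i,j,k,l)\in\{(0,1,2,3),(0,2,1,3),(0,3,1,2)\}$; (8) $\rho_0,\rho_1,\rho_2,\rho_3$ are pairwise distinct. In case (i) the $\rho$'s may be replaced by the $h$'s: $\rho_0=\rho_2\iff h_1=h_3$, $\rho_0=\rho_3\iff h_1=h_2$, $\rho_2=\rho_3\iff h_3=h_2$. In case (ii) they may be replaced by the $\xi$'s: $\rho_i=\rho_j\iff\xi_i=\xi_j$ for all $i,j\in\{0,1,2,3\}$. -/

import Mathlib

open scoped Kronecker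

/-- Vectors of three qubits `A`, `B`, `C`: the coefficient of `|ijk⟩` is the value at `(i, j, k)`. -/
abbrev ThreeQubit : Type := Fin 2 × Fin 2 × Fin 2 → ℂ

/-- The computational basis vector `|ijk⟩`. -/
def ket (i j k : Fin 2) : ThreeQubit := Pi.single (i, j, k) 1

/-- The vector `(A ⊗ B ⊗ C) ψ`. -/
def localAct (A B C : Matrix (Fin 2) (Fin 2) ℂ) (ψ : ThreeQubit) : ThreeQubit :=
  (A ⊗ₖ (B ⊗ₖ C)).mulVec ψ

/-- Equivalence under stochastic local operations and classical communication:
local invertible operators take `ψ` to `ψ'`. -/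
def SLOCCEquiv (ψ ψ' : ThreeQubit) : Prop :=
  ∃ A B C : Matrix (Fin 2) (Fin 2) ℂ, IsUnit A ∧ IsUnit B ∧ IsUnit C ∧ ψ' = localAct A B C ψ

/-- Local unitary equivalence: local unitary operators take `ψ` to `ψ'`. -/
def LUEquiv (ψ ψ' : ThreeQubit) : Prop :=
  ∃ A B C : Matrix (Fin 2) (Fin 2) ℂ, A ∈ Matrix.unitaryGroup (Fin 2) ℂ ∧
    B ∈ Matrix.unitaryGroup (Fin 2) ℂ ∧ C ∈ Matrix.unitaryGroup (Fin 2) ℂ ∧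
    ψ' = localAct A B C ψ

/-- The state `W = (|001⟩ + |010⟩ + |100⟩) / √3`. -/
noncomputable def wState : ThreeQubit :=
  (((1 / √3 : ℝ) : ℂ)) • (ket 0 0 1 + ket 0 1 0 + ket 1 0 0)

/-- The vector
`l₀|000⟩ + l₁ e^{iφ}|100⟩ + l₂|101⟩ + l₃|110⟩ + l₄|111⟩`. -/
noncomputable def asdVector (l : Fin 5 → ℝ) (φ : ℝ) : ThreeQubit :=
  (l 0 : ℂ) • ket 0 0 0 + ((l 1 : ℂ) * Complex.exp (Complex.I * (φ : ℂ))) • ket 1 0 0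
    + (l 2 : ℂ) • ket 1 0 1 + (l 3 : ℂ) • ket 1 1 0 + (l 4 : ℂ) • ket 1 1 1

/-- `(l, φ)` are the coefficients and the phase of an Acín–Schmidt decomposition of `ψ`. -/
def IsASD (ψ : ThreeQubit) (l : Fin 5 → ℝ) (φ : ℝ) : Prop :=
  (∀ i, 0 ≤ l i) ∧ ∑ i, l i ^ 2 = 1 ∧ φ ∈ Set.Ico 0 (2 * Real.pi) ∧
    LUEquiv ψ (asdVector l φ)

/-- The eight integer charges of an STU black hole: magnetic charges `pⁱ`, electric charges `qᵢ`. -/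
structure STUCharges where
  p : Fin 4 → ℤ
  q : Fin 4 → ℤ

namespace STUCharges

/-- The (unnormalized) three-qubit state `|ω⟩` of the black hole, through the dictionary
`(p⁰, p¹, p², p³, q₀, q₁, q₂, q₃) = (a₀₀₀, -a₀₀₁, -a₀₁₀, -a₁₀₀, a₁₁₁, a₁₁₀, a₁₀₁, a₀₁₁)`. -/
def state (c : STUCharges) : ThreeQubit :=
  (c.p 0 : ℂ) • ket 0 0 0 - (c.p 1 : ℂ) • ket 0 0 1 - (c.p 2 : ℂ) • ket 0 1 0
    + (c.q 3 : ℂ) • ket 0 1 1 - (c.p 3 : ℂ) • ket 1 0 0 + (c.q 2 : ℂ) • ket 1 0 1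
    + (c.q 1 : ℂ) • ket 1 1 0 + (c.q 0 : ℂ) • ket 1 1 1

/-- The sum of the squares of the eight charges. -/
def sumSq (c : STUCharges) : ℝ := ∑ i, ((c.q i : ℝ) ^ 2 + (c.p i : ℝ) ^ 2)

/-- The normalizing factor `η`. -/
noncomputable def eta (c : STUCharges) : ℝ := 1 / √c.sumSq

/-- The normalized state `η|ω⟩`. -/
noncomputable def normState (c : STUCharges) : ThreeQubit := (c.eta : ℂ) • c.state

/-- W black holes: the state belongs to the SLOCC class of the W state. -/
def IsW (c : STUCharges) : Prop := SLOCCEquiv wState c.state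

def h₁ (c : STUCharges) : ℝ :=
  ((c.p 0 : ℝ) * c.q 3 - c.p 1 * c.p 2 - c.p 3 * c.q 0 - c.q 2 * c.q 1) ^ 2

def h₂ (c : STUCharges) : ℝ :=
  ((c.p 0 : ℝ) * c.q 2 - c.p 1 * c.p 3 - c.p 2 * c.q 0 - c.q 3 * c.q 1) ^ 2

def h₃ (c : STUCharges) : ℝ :=
  ((c.p 0 : ℝ) * c.q 1 - c.p 2 * c.p 3 - c.p 1 * c.q 0 - c.q 3 * c.q 2) ^ 2

/-- `√(h₁h₂h₃)` -/
noncomputable def sqrtH (c : STUCharges) : ℝ := √(c.h₁ * c.h₂ * c.h₃)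

/-- The nonnegative numbers `ρ₀, ρ₁, ρ₂, ρ₃`, given through their squares. -/
noncomputable def rho (c : STUCharges) : Fin 4 → ℝ :=
  ![√(c.sqrtH / c.h₁),
    √(c.sumSq - (c.h₂ * c.h₃ + c.h₂ * c.h₁ + c.h₃ * c.h₁) / c.sqrtH),
    √(c.sqrtH / c.h₃),
    √(c.sqrtH / c.h₂)]

/-- `ξ₀ = 1/h₁`, `ξ₁ = ρ₁²/√(h₁h₂h₃)`, `ξ₂ = 1/h₃`, `ξ₃ = 1/h₂`. -/
noncomputable def xi (c : STUCharges) : Fin 4 → ℝ :=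
  ![1 / c.h₁, c.rho 1 ^ 2 / c.sqrtH, 1 / c.h₃, 1 / c.h₂]

end STUCharges

/-- `xᵢ = xⱼ = xₖ ≠ xₗ` -/
def EqThree (x : Fin 4 → ℝ) (i j k l : Fin 4) : Prop := x i = x j ∧ x j = x k ∧ x k ≠ x l

/-- `xᵢ = xⱼ` and `xᵢ ≠ xₖ ≠ xₗ ≠ xᵢ` -/
def EqPair (x : Fin 4 → ℝ) (i j k l : Fin 4) : Prop :=
  x i = x j ∧ x i ≠ x k ∧ x k ≠ x l ∧ x l ≠ x i

/-- `xᵢ = xⱼ ≠ xₖ = xₗ` -/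
def EqTwoPairs (x : Fin 4 → ℝ) (i j k l : Fin 4) : Prop := x i = x j ∧ x j ≠ x k ∧ x k = x l

/-- The eight equality patterns: `family k` is the family number `k + 1`;
the first three have `x₁ = 0`, the other five have `x₁ ≠ 0`. -/
def family : Fin 8 → (Fin 4 → ℝ) → Prop
  | 0, x => x 1 = 0 ∧ x 0 = x 2 ∧ x 2 = x 3
  | 1, x => x 1 = 0 ∧
      ((x 0 = x 3 ∧ x 3 ≠ x 2) ∨ (x 0 = x 2 ∧ x 2 ≠ x 3) ∨ (x 2 = x 3 ∧ x 3 ≠ x 0))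
  | 2, x => x 1 = 0 ∧ x 0 ≠ x 2 ∧ x 0 ≠ x 3 ∧ x 2 ≠ x 3
  | 3, x => x 1 ≠ 0 ∧ x 0 = x 1 ∧ x 1 = x 2 ∧ x 2 = x 3
  | 4, x => x 1 ≠ 0 ∧
      (EqThree x 0 1 2 3 ∨ EqThree x 0 1 3 2 ∨ EqThree x 0 2 3 1 ∨ EqThree x 1 2 3 0)
  | 5, x => x 1 ≠ 0 ∧
      (EqPair x 0 1 2 3 ∨ EqPair x 2 3 0 1 ∨ EqPair x 0 2 1 3 ∨ EqPair x 1 3 0 2 ∨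
        EqPair x 0 3 1 2 ∨ EqPair x 1 2 0 3)
  | 6, x => x 1 ≠ 0 ∧ (EqTwoPairs x 0 1 2 3 ∨ EqTwoPairs x 0 2 1 3 ∨ EqTwoPairs x 0 3 1 2)
  | 7, x => x 1 ≠ 0 ∧ ∀ i j : Fin 4, i ≠ j → x i ≠ x j

/-! Slicing a state along one qubit gives a binary quadratic form, the determinant of the pencil of
slices. Local operators act on its matrix by congruence, up to a product of two determinants
(`formA_localAct` and its analogues). For states in the SLOCC class of `W` all three forms are
nonzero and degenerate (`IsWClass`). Degeneracy lets unitaries rotate the three kernels onto basis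
vectors, which kills the coefficients at 001, 010, 011 and 111 (`IsWClass.coeff_eq_zero`). Diagonal
unitaries then make the remaining ones nonnegative, with an arbitrary phase at 100
(`luEquiv_asdVector_norm`). The Frobenius norms of the forms and the norm of the state are LU
invariants. Charges are real, so on a black hole they equal `4h₁`, `4h₂`, `4h₃` and `Σ`; on the
canonical form they are monomials in the coefficients and the sum of squares. Solving this system
gives `l = ρ` (`IsW.rho_eq`), so the `ρᵢ` are complete LU invariants. The families are the equality
patterns of four numbers, each realized by integer canonical forms. -/

/-- The polarization of the determinant of `2 × 2` matrices. -/
def mixedDet (X Y : Matrix (Fin 2) (Fin 2) ℂ) : ℂ :=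
  X 0 0 * Y 1 1 + X 1 1 * Y 0 0 - X 0 1 * Y 1 0 - X 1 0 * Y 0 1

/-- The symmetric matrix of the quadratic form `x ↦ 2 det (x₀ M₀ + x₁ M₁)`, where `M₀, M₁` are the
slices of `ψ` along the qubit `A`. -/
def formA (ψ : ThreeQubit) : Matrix (Fin 2) (Fin 2) ℂ :=
  Matrix.of fun i j => mixedDet (fun a b => ψ (i, a, b)) (fun a b => ψ (j, a, b))

/-- The analogue of `formA` for the slices along the qubit `B`. -/
def formB (ψ : ThreeQubit) : Matrix (Fin 2) (Fin 2) ℂ :=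
  Matrix.of fun i j => mixedDet (fun a b => ψ (a, i, b)) (fun a b => ψ (a, j, b))

/-- The analogue of `formA` for the slices along the qubit `C`. -/
def formC (ψ : ThreeQubit) : Matrix (Fin 2) (Fin 2) ℂ :=
  Matrix.of fun i j => mixedDet (fun a b => ψ (a, b, i)) (fun a b => ψ (a, b, j))

/-! ### Local operators and covariance of the forms -/

theorem localAct_apply (A B C : Matrix (Fin 2) (Fin 2) ℂ) (ψ : ThreeQubit) (i j k : Fin 2) :
    localAct A B C ψ (i, j, k) = ∑ a, ∑ b, ∑ c, A i a * (B j b * C k c) * ψ (a, b, c) := by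
  simp [localAct, Matrix.mulVec, dotProduct, Fintype.sum_prod_type]

theorem localAct_localAct (A B C A' B' C' : Matrix (Fin 2) (Fin 2) ℂ) (ψ : ThreeQubit) :
    localAct A B C (localAct A' B' C' ψ) = localAct (A * A') (B * B') (C * C') ψ := by
  simp [localAct, Matrix.mul_kronecker_mul]

theorem localAct_one (ψ : ThreeQubit) : localAct 1 1 1 ψ = ψ := by
  simp [localAct]

theorem localAct_smul (A B C : Matrix (Fin 2) (Fin 2) ℂ) (t : ℂ) (ψ : ThreeQubit) :
    localAct A B C (t • ψ) = t • localAct A B C ψ := by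
  simp [localAct, Matrix.mulVec_smul]

theorem formA_localAct (A B C : Matrix (Fin 2) (Fin 2) ℂ) (ψ : ThreeQubit) :
    formA (localAct A B C ψ) = (B.det * C.det) • (A * formA ψ * A.transpose) := by
  ext i j
  simp only [formA, mixedDet, Matrix.of_apply, localAct_apply, Fin.sum_univ_two, Matrix.smul_apply,
    Matrix.mul_apply, Matrix.transpose_apply, Matrix.det_fin_two, smul_eq_mul]
  ring

theorem formB_localAct (A B C : Matrix (Fin 2) (Fin 2) ℂ) (ψ : ThreeQubit) :
    formB (localAct A B C ψ) = (A.det * C.det) • (B * formB ψ * B.transpose) := by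
  ext i j
  simp only [formB, mixedDet, Matrix.of_apply, localAct_apply, Fin.sum_univ_two, Matrix.smul_apply,
    Matrix.mul_apply, Matrix.transpose_apply, Matrix.det_fin_two, smul_eq_mul]
  ring

theorem formC_localAct (A B C : Matrix (Fin 2) (Fin 2) ℂ) (ψ : ThreeQubit) :
    formC (localAct A B C ψ) = (A.det * B.det) • (C * formC ψ * C.transpose) := by
  ext i j
  simp only [formC, mixedDet, Matrix.of_apply, localAct_apply, Fin.sum_univ_two, Matrix.smul_apply,
    Matrix.mul_apply, Matrix.transpose_apply, Matrix.det_fin_two, smul_eq_mul]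
  ring

/-! ### LU invariants -/

/-- The squared norm of a vector of three qubits. -/
def normSqSum (ψ : ThreeQubit) : ℂ := dotProduct (star ψ) ψ

/-- The squared Frobenius norm of a matrix. -/
def frobSq (S : Matrix (Fin 2) (Fin 2) ℂ) : ℂ := (S * S.conjTranspose).trace

/-- The transpose of a unitary is unitary, so congruence by `U` multiplies `S` by unitaries on both
sides; the scalar has modulus one. -/
theorem frobSq_congr {U S : Matrix (Fin 2) (Fin 2) ℂ} {t : ℂ}
    (hU : U ∈ Matrix.unitaryGroup (Fin 2) ℂ) (ht : t * star t = 1) :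
    frobSq (t • (U * S * U.transpose)) = frobSq S := by
  have h1 : U.conjTranspose * U = 1 := Matrix.mem_unitaryGroup_iff'.1 hU
  have h2 : U.transpose * U.transpose.conjTranspose = 1 := by
    have := congrArg Matrix.transpose h1
    simpa [Matrix.transpose_mul, Matrix.conjTranspose, Matrix.transpose_map] using this
  unfold frobSq
  rw [Matrix.conjTranspose_smul, Matrix.smul_mul, Matrix.mul_smul, smul_smul, ht, one_smul,
    Matrix.conjTranspose_mul, Matrix.conjTranspose_mul]
  calc (U * S * U.transpose * (U.transpose.conjTranspose * (S.conjTranspose * U.conjTranspose))).trace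
      = (U * (S * (U.transpose * U.transpose.conjTranspose) * S.conjTranspose)
          * U.conjTranspose).trace := by simp only [Matrix.mul_assoc]
    _ = (S * S.conjTranspose).trace := by
      rw [h2, Matrix.mul_one, Matrix.trace_mul_comm, ← Matrix.mul_assoc, h1, Matrix.one_mul]

theorem det_mul_star_of_mem_unitaryGroup {U V : Matrix (Fin 2) (Fin 2) ℂ}
    (hU : U ∈ Matrix.unitaryGroup (Fin 2) ℂ) (hV : V ∈ Matrix.unitaryGroup (Fin 2) ℂ) :
    U.det * V.det * star (U.det * V.det) = 1 := by
  have h1 := (Matrix.det_of_mem_unitary hU)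
  have h2 := (Matrix.det_of_mem_unitary hV)
  exact (Unitary.mem_iff.1 (mul_mem h1 h2)).2

namespace LUEquiv

theorem refl (ψ : ThreeQubit) : LUEquiv ψ ψ :=
  ⟨1, 1, 1, one_mem _, one_mem _, one_mem _, (localAct_one ψ).symm⟩

theorem trans {ψ χ ω : ThreeQubit} : LUEquiv ψ χ → LUEquiv χ ω → LUEquiv ψ ω := by
  rintro ⟨A, B, C, hA, hB, hC, rfl⟩ ⟨A', B', C', hA', hB', hC', rfl⟩
  exact ⟨A' * A, B' * B, C' * C, mul_mem hA' hA, mul_mem hB' hB, mul_mem hC' hC,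
    localAct_localAct ..⟩

theorem symm {ψ χ : ThreeQubit} : LUEquiv ψ χ → LUEquiv χ ψ := by
  rintro ⟨A, B, C, hA, hB, hC, rfl⟩
  refine ⟨star A, star B, star C, Unitary.star_mem hA, Unitary.star_mem hB, Unitary.star_mem hC, ?_⟩
  rw [localAct_localAct, (Unitary.mem_iff.1 hA).1, (Unitary.mem_iff.1 hB).1,
    (Unitary.mem_iff.1 hC).1, localAct_one]

theorem smul {ψ χ : ThreeQubit} (t : ℂ) : LUEquiv ψ χ → LUEquiv (t • ψ) (t • χ) := by
  rintro ⟨A, B, C, hA, hB, hC, rfl⟩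
  exact ⟨A, B, C, hA, hB, hC, (localAct_smul ..).symm⟩

theorem frobSq_formA {ψ χ : ThreeQubit} :
    LUEquiv ψ χ → frobSq (formA χ) = frobSq (formA ψ) := by
  rintro ⟨A, B, C, hA, hB, hC, rfl⟩
  rw [formA_localAct, frobSq_congr hA (det_mul_star_of_mem_unitaryGroup hB hC)]

theorem frobSq_formB {ψ χ : ThreeQubit} :
    LUEquiv ψ χ → frobSq (formB χ) = frobSq (formB ψ) := by
  rintro ⟨A, B, C, hA, hB, hC, rfl⟩
  rw [formB_localAct, frobSq_congr hB (det_mul_star_of_mem_unitaryGroup hA hC)]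

theorem frobSq_formC {ψ χ : ThreeQubit} :
    LUEquiv ψ χ → frobSq (formC χ) = frobSq (formC ψ) := by
  rintro ⟨A, B, C, hA, hB, hC, rfl⟩
  rw [formC_localAct, frobSq_congr hC (det_mul_star_of_mem_unitaryGroup hA hB)]

theorem normSqSum_eq {ψ χ : ThreeQubit} : LUEquiv ψ χ → normSqSum χ = normSqSum ψ := by
  rintro ⟨A, B, C, hA, hB, hC, rfl⟩
  have hU : (A ⊗ₖ (B ⊗ₖ C)).conjTranspose * (A ⊗ₖ (B ⊗ₖ C)) = 1 := by
    have h1 : A.conjTranspose * A = 1 := (Unitary.mem_iff.1 hA).1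
    have h2 : B.conjTranspose * B = 1 := (Unitary.mem_iff.1 hB).1
    have h3 : C.conjTranspose * C = 1 := (Unitary.mem_iff.1 hC).1
    simp [Matrix.conjTranspose_kronecker, ← Matrix.mul_kronecker_mul, h1, h2, h3]
  unfold normSqSum localAct
  rw [Matrix.star_mulVec, Matrix.dotProduct_mulVec, Matrix.vecMul_vecMul, hU, Matrix.vecMul_one]

end LUEquiv

/-! ### The class of `W` in terms of the forms -/

/-- The three quadratic forms of `ψ` are nonzero and degenerate. -/
def IsWClass (ψ : ThreeQubit) : Prop :=
  (formA ψ ≠ 0 ∧ formB ψ ≠ 0 ∧ formC ψ ≠ 0) ∧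
    (formA ψ).det = 0 ∧ (formB ψ).det = 0 ∧ (formC ψ).det = 0

theorem smul_congr_ne_zero {U S : Matrix (Fin 2) (Fin 2) ℂ} {t : ℂ} (hU : IsUnit U) (ht : t ≠ 0)
    (hS : S ≠ 0) : t • (U * S * U.transpose) ≠ 0 := by
  have hU' : IsUnit U.transpose := by
    rw [Matrix.isUnit_iff_isUnit_det] at hU ⊢; rwa [Matrix.det_transpose]
  rw [Ne, smul_eq_zero, not_or]
  refine ⟨ht, fun h => hS ?_⟩
  rw [hU'.mul_left_eq_zero] at h
  rwa [hU.mul_right_eq_zero] at h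

theorem det_smul_congr {U S : Matrix (Fin 2) (Fin 2) ℂ} {t : ℂ} (hS : S.det = 0) :
    (t • (U * S * U.transpose)).det = 0 := by
  simp [hS]

theorem IsWClass.map {A B C : Matrix (Fin 2) (Fin 2) ℂ} {ψ : ThreeQubit} (h : IsWClass ψ)
    (hA : IsUnit A) (hB : IsUnit B) (hC : IsUnit C) : IsWClass (localAct A B C ψ) := by
  obtain ⟨⟨h1, h2, h3⟩, h4, h5, h6⟩ := h
  have dA := ((Matrix.isUnit_iff_isUnit_det _).1 hA).ne_zero
  have dB := ((Matrix.isUnit_iff_isUnit_det _).1 hB).ne_zero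
  have dC := ((Matrix.isUnit_iff_isUnit_det _).1 hC).ne_zero
  unfold IsWClass
  rw [formA_localAct, formB_localAct, formC_localAct]
  exact ⟨⟨smul_congr_ne_zero hA (mul_ne_zero dB dC) h1, smul_congr_ne_zero hB (mul_ne_zero dA dC) h2,
    smul_congr_ne_zero hC (mul_ne_zero dA dB) h3⟩, det_smul_congr h4, det_smul_congr h5,
    det_smul_congr h6⟩

theorem isUnit_of_mem_unitaryGroup {U : Matrix (Fin 2) (Fin 2) ℂ}
    (hU : U ∈ Matrix.unitaryGroup (Fin 2) ℂ) : IsUnit U :=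
  ⟨⟨U, star U, (Unitary.mem_iff.1 hU).2, (Unitary.mem_iff.1 hU).1⟩, rfl⟩

theorem IsWClass.of_luEquiv {ψ χ : ThreeQubit} (h : IsWClass ψ) : LUEquiv ψ χ → IsWClass χ := by
  rintro ⟨A, B, C, hA, hB, hC, rfl⟩
  exact h.map (isUnit_of_mem_unitaryGroup hA) (isUnit_of_mem_unitaryGroup hB)
    (isUnit_of_mem_unitaryGroup hC)

theorem isWClass_wState : IsWClass wState := by
  -- This is the `00` entry, `-2/3`, common to the three forms of `W`.
  have h3 : ¬ -(((√3 : ℝ) : ℂ)⁻¹ * ((√3 : ℝ) : ℂ)⁻¹) - ((√3 : ℝ) : ℂ)⁻¹ * ((√3 : ℝ) : ℂ)⁻¹ = 0 := by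
    rw [← neg_add', neg_eq_zero, ← two_mul]
    simp
  refine ⟨⟨fun h => ?_, fun h => ?_, fun h => ?_⟩, ?_, ?_, ?_⟩
  · simpa [formA, mixedDet, wState, ket, h3] using congrFun₂ h 0 0
  · simpa [formB, mixedDet, wState, ket, h3] using congrFun₂ h 0 0
  · simpa [formC, mixedDet, wState, ket, h3] using congrFun₂ h 0 0
  all_goals simp [Matrix.det_fin_two, formA, formB, formC, mixedDet, wState, ket]

theorem STUCharges.IsW.isWClass {c : STUCharges} : c.IsW → IsWClass c.state := by
  rintro ⟨A, B, C, hA, hB, hC, h⟩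
  rw [h]
  exact isWClass_wState.map hA hB hC

/-! ### Reduction to the canonical form -/

/-- A `2 × 2` matrix with vanishing determinant has a left kernel vector of norm one, which is the
first row of a unitary matrix. -/
theorem exists_unitary_of_det_eq_zero {S : Matrix (Fin 2) (Fin 2) ℂ} (hS : S.det = 0) :
    ∃ U ∈ Matrix.unitaryGroup (Fin 2) ℂ, ∀ j, (U * S) 0 j = 0 := by
  obtain ⟨v, hv, hvS⟩ := Matrix.exists_vecMul_eq_zero_iff.2 hS
  set n : ℝ := √(Complex.normSq (v 0) + Complex.normSq (v 1)) with hn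
  have hpos : 0 < Complex.normSq (v 0) + Complex.normSq (v 1) := by
    rcases (add_nonneg (Complex.normSq_nonneg (v 0)) (Complex.normSq_nonneg (v 1))).eq_or_lt
      with h | h
    · refine absurd ?_ hv
      have h0 := Complex.normSq_nonneg (v 0)
      have h1 := Complex.normSq_nonneg (v 1)
      ext i
      fin_cases i
      · exact Complex.normSq_eq_zero.1 (show Complex.normSq (v 0) = 0 by linarith)
      · exact Complex.normSq_eq_zero.1 (show Complex.normSq (v 1) = 0 by linarith)
    · exact h
  have hn0 : (n : ℂ) ≠ 0 := by
    simpa [hn] using (Real.sqrt_pos.2 hpos).ne'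
  have hn2 : (n : ℂ) ^ 2 = v 0 * star (v 0) + v 1 * star (v 1) := by
    rw [← Complex.ofReal_pow, hn, Real.sq_sqrt hpos.le]
    simp [Complex.mul_conj]
  -- The second row completes the normalized kernel vector to an orthonormal basis.
  refine ⟨!![v 0 / n, v 1 / n; -(star (v 1) / n), star (v 0) / n], ?_, fun j => ?_⟩
  · rw [Matrix.mem_unitaryGroup_iff]
    ext i j
    fin_cases i <;> fin_cases j <;>
      simp [Matrix.mul_apply, Fin.sum_univ_two, Matrix.star_apply] <;> field_simp <;>
      simp [hn2] <;> ring
  · have := congrFun hvS j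
    simp only [Matrix.vecMul, dotProduct, Fin.sum_univ_two, Pi.zero_apply] at this
    simp only [Matrix.mul_apply, Fin.sum_univ_two, Matrix.of_apply, Matrix.cons_val', Matrix.cons_val_zero,
      Matrix.cons_val_one, Matrix.cons_val_fin_one]
    field_simp
    linear_combination this

theorem exists_unitary_congr_row_eq_zero {S : Matrix (Fin 2) (Fin 2) ℂ} (hS : S.det = 0)
    (r : Fin 2) :
    ∃ U ∈ Matrix.unitaryGroup (Fin 2) ℂ, ∀ j, (U * S * U.transpose) r j = 0 := by
  obtain ⟨U, hU, hUS⟩ := exists_unitary_of_det_eq_zero hS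
  obtain ⟨V, hV, hVS⟩ : ∃ V ∈ Matrix.unitaryGroup (Fin 2) ℂ, ∀ j, (V * S) r j = 0 := by
    fin_cases r
    · exact ⟨U, hU, hUS⟩
    -- Swapping rows moves the zero row from position 0 to position 1.
    · refine ⟨!![0, 1; 1, 0] * U, mul_mem ?_ hU, fun j => ?_⟩
      · rw [Matrix.mem_unitaryGroup_iff]
        ext i j
        fin_cases i <;> fin_cases j <;> simp [Matrix.mul_apply, Matrix.star_apply]
      · rw [Matrix.mul_assoc, Matrix.mul_apply]
        simp [hUS]
  refine ⟨V, hV, fun j => ?_⟩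
  rw [Matrix.mul_apply]
  simp [hVS]

theorem formA_symm (ψ : ThreeQubit) : formA ψ 1 0 = formA ψ 0 1 := by
  simp only [formA, mixedDet, Matrix.of_apply]; ring

theorem formB_symm (ψ : ThreeQubit) : formB ψ 0 1 = formB ψ 1 0 := by
  simp only [formB, mixedDet, Matrix.of_apply]; ring

theorem formC_symm (ψ : ThreeQubit) : formC ψ 0 1 = formC ψ 1 0 := by
  simp only [formC, mixedDet, Matrix.of_apply]; ring

/-- If the forms of a vector of class `W` are diagonal with a zero at `00`, `11`, `11`, then four of
its coefficients vanish. -/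
theorem IsWClass.coeff_eq_zero {ψ : ThreeQubit} (h : IsWClass ψ) (hA : ∀ j, formA ψ 0 j = 0)
    (hB : ∀ j, formB ψ 1 j = 0) (hC : ∀ j, formC ψ 1 j = 0) :
    ψ (0, 0, 1) = 0 ∧ ψ (0, 1, 0) = 0 ∧ ψ (0, 1, 1) = 0 ∧ ψ (1, 1, 1) = 0 := by
  have nA : formA ψ 1 1 ≠ 0 := fun h0 => h.1.1 <| by
    ext i j; fin_cases i <;> fin_cases j <;> simp [hA, h0, formA_symm]
  have nB : formB ψ 0 0 ≠ 0 := fun h0 => h.1.2.1 <| by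
    ext i j; fin_cases i <;> fin_cases j <;> simp [hB, h0, formB_symm]
  have nC : formC ψ 0 0 ≠ 0 := fun h0 => h.1.2.2 <| by
    ext i j; fin_cases i <;> fin_cases j <;> simp [hC, h0, formC_symm]
  have a0 := hA 0
  have a1 := hA 1
  have b0 := hB 0
  have b1 := hB 1
  have c0 := hC 0
  have c1 := hC 1
  simp only [formA, formB, formC, mixedDet, Matrix.of_apply] at nA nB nC a0 a1 b0 b1 c0 c1
  generalize ψ (0, 0, 0) = a at *
  generalize ψ (0, 0, 1) = b at *
  generalize ψ (0, 1, 0) = c at *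
  generalize ψ (0, 1, 1) = d at *
  generalize ψ (1, 0, 0) = e at *
  generalize ψ (1, 0, 1) = f at *
  generalize ψ (1, 1, 0) = g at *
  generalize ψ (1, 1, 1) = k at *
  -- The three off-diagonal entries vanish exactly when the four products over complementary indices
  -- agree: `ak = bg = cf = de`.
  have e1 : a * k = b * g := by linear_combination a1 / 2 + b0 / 2
  have e2 : a * k = c * f := by linear_combination a1 / 2 + c0 / 2
  have e3 : a * k = d * e := by linear_combination b0 / 2 + c0 / 2
  have e4 : c * k = d * g := by linear_combination b1 / 2
  have e5 : b * k = d * f := by linear_combination c1 / 2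
  have nA' : e * k - f * g ≠ 0 := fun h0 => nA (by linear_combination 2 * h0)
  have nB' : a * f - b * e ≠ 0 := fun h0 => nB (by linear_combination 2 * h0)
  have hd : d = 0 := by
    have : d * (e * k - f * g) = 0 := by linear_combination g * e5 - k * e3 + k * e1
    exact (mul_eq_zero.1 this).resolve_right nA'
  subst hd
  have hk : k = 0 := by
    by_contra hk
    have hc : c = 0 := by simpa [hk] using e4
    have hb : b = 0 := by simpa [hk] using e5
    have ha : a = 0 := by simpa [hk] using e3
    exact nB' (by rw [ha, hb]; ring)
  subst hk
  have hfg : f ≠ 0 ∧ g ≠ 0 := by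
    constructor <;> rintro rfl <;> simp at nA'
  refine ⟨?_, ?_, rfl, rfl⟩
  · simpa [hfg.2] using e1.symm
  · simpa [hfg.1] using e2.symm

theorem exists_unit_mul_eq_norm (z : ℂ) : ∃ u : ℂ, u * star u = 1 ∧ u * z = (‖z‖ : ℂ) := by
  rcases eq_or_ne z 0 with rfl | hz
  · exact ⟨1, by simp, by simp⟩
  · have hn : ((‖z‖ : ℝ) : ℂ) ≠ 0 := by simpa using hz
    have h2 : star z * z = (‖z‖ : ℂ) ^ 2 := by
      simpa using Complex.conj_mul' z
    refine ⟨star z / ‖z‖, ?_, ?_⟩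
    · simp only [star_div₀, star_star]
      have : star ((‖z‖ : ℝ) : ℂ) = (‖z‖ : ℂ) := Complex.conj_ofReal _
      rw [this]
      field_simp
      linear_combination h2
    · field_simp
      linear_combination h2

theorem diagonal_mem_unitaryGroup {u v : ℂ} (hu : u * star u = 1) (hv : v * star v = 1) :
    !![u, 0; 0, v] ∈ Matrix.unitaryGroup (Fin 2) ℂ := by
  rw [Matrix.mem_unitaryGroup_iff]
  have hu' : u * (starRingEnd ℂ) u = 1 := hu
  have hv' : v * (starRingEnd ℂ) v = 1 := hv
  ext i j
  fin_cases i <;> fin_cases j <;>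
    simp [Matrix.mul_apply, Fin.sum_univ_two, Matrix.star_apply, hu', hv']

/-- Local phases make the coefficients of a generalized `W` vector nonnegative, up to an arbitrary
phase of one of them. -/
theorem luEquiv_asdVector_norm {ψ : ThreeQubit} (h1 : ψ (0, 0, 1) = 0) (h2 : ψ (0, 1, 0) = 0)
    (h3 : ψ (0, 1, 1) = 0) (h4 : ψ (1, 1, 1) = 0) (φ : ℝ) :
    LUEquiv ψ (asdVector
      ![‖ψ (0, 0, 0)‖, ‖ψ (1, 0, 0)‖, ‖ψ (1, 0, 1)‖, ‖ψ (1, 1, 0)‖, 0] φ) := by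
  obtain ⟨u₀, hu₀, e₀⟩ := exists_unit_mul_eq_norm (ψ (0, 0, 0))
  obtain ⟨u₁, hu₁, e₁⟩ := exists_unit_mul_eq_norm (ψ (1, 0, 0))
  obtain ⟨u₂, hu₂, e₂⟩ := exists_unit_mul_eq_norm (ψ (1, 0, 1))
  obtain ⟨u₃, hu₃, e₃⟩ := exists_unit_mul_eq_norm (ψ (1, 1, 0))
  set w := Complex.exp (Complex.I * (φ : ℂ)) with hw
  have hww : w * star w = 1 := by
    have : ‖w‖ = 1 := by rw [hw, mul_comm]; exact Complex.norm_exp_ofReal_mul_I φ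
    have h := Complex.mul_conj' w
    rw [this] at h
    simpa using h
  -- The phase `v` on `|1⟩` of the first qubit sets the phase at 100; the other two qubits undo it
  -- at 101 and 110 through `star v`. Since the coefficient at 111 is zero, no further condition
  -- arises and `φ` stays free.
  obtain ⟨v, hv, ev⟩ : ∃ v : ℂ, v * star v = 1 ∧ v * ψ (1, 0, 0) = w * ‖ψ (1, 0, 0)‖ := by
    refine ⟨w * u₁, ?_, by linear_combination w * e₁⟩
    rw [star_mul']; linear_combination (w * star w) * hu₁ + hww
  have hβ {u : ℂ} (hu : u * star u = 1) : (u * star v) * star (u * star v) = 1 := by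
    rw [star_mul', star_star]
    linear_combination (v * star v) * hu + hv
  refine ⟨_, _, _, diagonal_mem_unitaryGroup hu₀ hv,
    diagonal_mem_unitaryGroup (u := 1) (by simp) (hβ hu₃),
    diagonal_mem_unitaryGroup (u := 1) (by simp) (hβ hu₂), ?_⟩
  ext ⟨i, j, k⟩
  rw [localAct_apply]
  fin_cases i <;> fin_cases j <;> fin_cases k <;>
    simp only [Fin.sum_univ_two, asdVector, ket, h1, h2, h3, h4, Fin.zero_eta, Fin.mk_one,
      Pi.add_apply, Pi.smul_apply, Pi.single_apply] <;>
    simp [-Complex.star_def, -RCLike.star_def, -star_mul']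
  · exact e₀.symm
  · rw [mul_comm]; exact ev.symm
  · linear_combination -e₂ - u₂ * ψ (1, 0, 1) * hv
  · linear_combination -e₃ - u₃ * ψ (1, 1, 0) * hv

theorem IsWClass.exists_asdVector {ψ : ThreeQubit} (h : IsWClass ψ) (φ : ℝ) :
    ∃ l : Fin 5 → ℝ, (∀ i, 0 ≤ l i) ∧ LUEquiv ψ (asdVector l φ) := by
  obtain ⟨A, hA, zA⟩ := exists_unitary_congr_row_eq_zero h.2.1 0
  obtain ⟨B, hB, zB⟩ := exists_unitary_congr_row_eq_zero h.2.2.1 1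
  obtain ⟨C, hC, zC⟩ := exists_unitary_congr_row_eq_zero h.2.2.2 1
  have hLU : LUEquiv ψ (localAct A B C ψ) := ⟨A, B, C, hA, hB, hC, rfl⟩
  obtain ⟨h1, h2, h3, h4⟩ := (h.of_luEquiv hLU).coeff_eq_zero
    (fun j => by simp [formA_localAct, zA]) (fun j => by simp [formB_localAct, zB])
    (fun j => by simp [formC_localAct, zC])
  refine ⟨_, fun i => ?_, hLU.trans (luEquiv_asdVector_norm h1 h2 h3 h4 φ)⟩
  fin_cases i <;> simp

/-! ### Invariants of decompositions and of black holes -/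

theorem formA_asdVector (l : Fin 5 → ℝ) (φ : ℝ) : formA (asdVector l φ) =
    !![0, (l 0 * l 4 : ℂ); (l 0 * l 4 : ℂ),
      2 * (l 1 * Complex.exp (Complex.I * φ) * l 4 - l 2 * l 3)] := by
  ext i j
  fin_cases i <;> fin_cases j <;> simp [formA, mixedDet, asdVector, ket, Pi.single_apply] <;> ring

theorem formB_asdVector (l : Fin 5 → ℝ) (φ : ℝ) : formB (asdVector l φ) =
    !![(2 * (l 0 * l 2) : ℂ), (l 0 * l 4 : ℂ); (l 0 * l 4 : ℂ), 0] := by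
  ext i j
  fin_cases i <;> fin_cases j <;> simp [formB, mixedDet, asdVector, ket, Pi.single_apply] <;> ring

theorem formC_asdVector (l : Fin 5 → ℝ) (φ : ℝ) : formC (asdVector l φ) =
    !![(2 * (l 0 * l 3) : ℂ), (l 0 * l 4 : ℂ); (l 0 * l 4 : ℂ), 0] := by
  ext i j
  fin_cases i <;> fin_cases j <;> simp [formC, mixedDet, asdVector, ket, Pi.single_apply] <;> ring

theorem normSqSum_asdVector (l : Fin 5 → ℝ) (φ : ℝ) :
    normSqSum (asdVector l φ) = ((∑ i, l i ^ 2 : ℝ) : ℂ) := by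
  set w := Complex.exp (Complex.I * (φ : ℂ)) with hw
  have hww : (starRingEnd ℂ) w * w = 1 := by
    have : ‖w‖ = 1 := by rw [hw, mul_comm]; exact Complex.norm_exp_ofReal_mul_I φ
    simpa [this] using Complex.conj_mul' w
  simp only [normSqSum, dotProduct, Fintype.sum_prod_type, Fin.sum_univ_two, asdVector, ket,
    ← hw, Pi.add_apply, Pi.smul_apply, Pi.single_apply, Pi.star_apply]
  simp [Fin.sum_univ_succ]
  linear_combination (l 1 : ℂ) ^ 2 * hww

theorem frobSq_eq (S : Matrix (Fin 2) (Fin 2) ℂ) :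
    frobSq S = S 0 0 * star (S 0 0) + S 0 1 * star (S 0 1)
      + (S 1 0 * star (S 1 0) + S 1 1 * star (S 1 1)) := by
  simp [frobSq, Matrix.trace_fin_two, Matrix.mul_apply]

/-- Degeneracy replaces the squared off-diagonal entry by the product of the diagonal ones, which
completes the square of the trace. -/
theorem frobSq_of_real {S : Matrix (Fin 2) (Fin 2) ℂ} (hS : S.det = 0) (hsymm : S 1 0 = S 0 1)
    (hreal : ∀ i j, star (S i j) = S i j) : frobSq S = (S 0 0 + S 1 1) ^ 2 := by
  rw [Matrix.det_fin_two, hsymm] at hS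
  rw [frobSq_eq]
  simp only [hreal, hsymm]
  linear_combination -2 * hS

namespace STUCharges

theorem star_state (c : STUCharges) (i : Fin 2 × Fin 2 × Fin 2) :
    (starRingEnd ℂ) (c.state i) = c.state i := by
  simp only [state, ket, Pi.add_apply, Pi.sub_apply, Pi.smul_apply, Pi.single_apply]
  simp [apply_ite (starRingEnd ℂ)]

theorem normSqSum_state (c : STUCharges) : normSqSum c.state = (c.sumSq : ℂ) := by
  simp only [normSqSum, dotProduct, Pi.star_apply, Complex.star_def, star_state,
    Fintype.sum_prod_type, Fin.sum_univ_two]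
  simp [state, ket, sumSq, Fin.sum_univ_four]
  ring

/-- The trace of the form is twice the expression whose square is `h₁`. -/
theorem frobSq_formA_state {c : STUCharges} (h : (formA c.state).det = 0) :
    frobSq (formA c.state) = ((4 * c.h₁ : ℝ) : ℂ) := by
  rw [frobSq_of_real h (formA_symm _) (fun i j => by simp [formA, mixedDet, star_state])]
  simp [formA, mixedDet, state, ket, Pi.single_apply, h₁]
  ring

theorem frobSq_formB_state {c : STUCharges} (h : (formB c.state).det = 0) :
    frobSq (formB c.state) = ((4 * c.h₂ : ℝ) : ℂ) := by
  rw [frobSq_of_real h (formB_symm _).symm (fun i j => by simp [formB, mixedDet, star_state])]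
  simp [formB, mixedDet, state, ket, Pi.single_apply, h₂]
  ring

theorem frobSq_formC_state {c : STUCharges} (h : (formC c.state).det = 0) :
    frobSq (formC c.state) = ((4 * c.h₃ : ℝ) : ℂ) := by
  rw [frobSq_of_real h (formC_symm _).symm (fun i j => by simp [formC, mixedDet, star_state])]
  simp [formC, mixedDet, state, ket, Pi.single_apply, h₃]
  ring

/-- The coefficients of a decomposition of `|ω⟩` in terms of the invariants `hᵢ` and `Σ`. -/
theorem IsW.invariants_eq {c : STUCharges} (hc : c.IsW) {l : Fin 5 → ℝ} {φ : ℝ}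
    (hl : ∀ i, 0 ≤ l i) (h : LUEquiv c.state (asdVector l φ)) :
    l 4 = 0 ∧ (0 < l 0 ∧ 0 < l 2 ∧ 0 < l 3) ∧ c.h₁ = (l 2 * l 3) ^ 2 ∧ c.h₂ = (l 0 * l 2) ^ 2 ∧
      c.h₃ = (l 0 * l 3) ^ 2 ∧ c.sumSq = l 0 ^ 2 + l 1 ^ 2 + l 2 ^ 2 + l 3 ^ 2 := by
  have hW := hc.isWClass
  have hW' := hW.of_luEquiv h
  obtain ⟨⟨nA, nB, nC⟩, dA, dB, dC⟩ := hW'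
  have h0 : l 0 ≠ 0 := fun h0 => nB <| by
    rw [formB_asdVector, h0]; ext i j; fin_cases i <;> fin_cases j <;> simp
  -- The determinant of the form along `B` is `-(l 0 * l 4) ^ 2`. Once `l 4` vanishes, so does the
  -- only entry containing `φ`.
  have h4 : l 4 = 0 := by
    rw [formB_asdVector, Matrix.det_fin_two] at dB
    simpa [h0] using dB
  have h2 : l 2 ≠ 0 := fun h2 => nA <| by
    rw [formA_asdVector, h2, h4]; ext i j; fin_cases i <;> fin_cases j <;> simp
  have h3 : l 3 ≠ 0 := fun h3 => nA <| by
    rw [formA_asdVector, h3, h4]; ext i j; fin_cases i <;> fin_cases j <;> simp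
  have eA := h.frobSq_formA
  have eB := h.frobSq_formB
  have eC := h.frobSq_formC
  have eN := h.normSqSum_eq
  rw [frobSq_formA_state hW.2.1, formA_asdVector, frobSq_eq, h4] at eA
  rw [frobSq_formB_state hW.2.2.1, formB_asdVector, frobSq_eq, h4] at eB
  rw [frobSq_formC_state hW.2.2.2, formC_asdVector, frobSq_eq, h4] at eC
  rw [normSqSum_state, normSqSum_asdVector, Complex.ofReal_inj] at eN
  have kA : ((2 * (l 2 * l 3) * (2 * (l 2 * l 3)) : ℝ) : ℂ) = (4 * c.h₁ : ℝ) := by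
    rw [← eA]; simp
  have kB : ((2 * (l 0 * l 2) * (2 * (l 0 * l 2)) : ℝ) : ℂ) = (4 * c.h₂ : ℝ) := by
    rw [← eB]; simp
  have kC : ((2 * (l 0 * l 3) * (2 * (l 0 * l 3)) : ℝ) : ℂ) = (4 * c.h₃ : ℝ) := by
    rw [← eC]; simp
  rw [Complex.ofReal_inj] at kA kB kC
  refine ⟨h4, ⟨(hl 0).lt_of_ne' h0, (hl 2).lt_of_ne' h2, (hl 3).lt_of_ne' h3⟩, ?_, ?_, ?_, ?_⟩
  · linear_combination -kA / 4
  · linear_combination -kB / 4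
  · linear_combination -kC / 4
  · rw [← eN, Fin.sum_univ_five, h4]; ring

/-- The coefficients of a decomposition of `|ω⟩` are the `ρᵢ`. -/
theorem IsW.rho_eq {c : STUCharges} (hc : c.IsW) {l : Fin 5 → ℝ} {φ : ℝ}
    (hl : ∀ i, 0 ≤ l i) (h : LUEquiv c.state (asdVector l φ)) :
    l = ![c.rho 0, c.rho 1, c.rho 2, c.rho 3, 0] := by
  obtain ⟨h4, ⟨p0, p2, p3⟩, e1, e2, e3, eN⟩ := hc.invariants_eq hl h
  -- Each of the three coefficients occurs in two of the `hᵢ`, so dividing this root by one `hᵢ`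
  -- isolates the square of the coefficient absent from it.
  have hs : c.sqrtH = (l 0 * l 2 * l 3) ^ 2 := by
    rw [sqrtH, e1, e2, e3, show (l 2 * l 3) ^ 2 * (l 0 * l 2) ^ 2 * (l 0 * l 3) ^ 2
      = ((l 0 * l 2 * l 3) ^ 2) ^ 2 by ring, Real.sqrt_sq (by positivity)]
  have r0 : c.rho 0 = l 0 := by
    show √(c.sqrtH / c.h₁) = l 0
    rw [hs, e1, show (l 0 * l 2 * l 3) ^ 2 / (l 2 * l 3) ^ 2 = l 0 ^ 2 by field_simp,
      Real.sqrt_sq p0.le]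
  have r2 : c.rho 2 = l 2 := by
    show √(c.sqrtH / c.h₃) = l 2
    rw [hs, e3, show (l 0 * l 2 * l 3) ^ 2 / (l 0 * l 3) ^ 2 = l 2 ^ 2 by field_simp,
      Real.sqrt_sq p2.le]
  have r3 : c.rho 3 = l 3 := by
    show √(c.sqrtH / c.h₂) = l 3
    rw [hs, e2, show (l 0 * l 2 * l 3) ^ 2 / (l 0 * l 2) ^ 2 = l 3 ^ 2 by field_simp,
      Real.sqrt_sq p3.le]
  have r1 : c.rho 1 = l 1 := by
    show √(c.sumSq - (c.h₂ * c.h₃ + c.h₂ * c.h₁ + c.h₃ * c.h₁) / c.sqrtH) = l 1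
    -- The three pairwise products of the `hᵢ`, divided by `sqrtH`, are the squares of `l 0`, `l 2`,
    -- `l 3`.
    rw [hs, e1, e2, e3, eN, show l 0 ^ 2 + l 1 ^ 2 + l 2 ^ 2 + l 3 ^ 2 -
      ((l 0 * l 2) ^ 2 * (l 0 * l 3) ^ 2 + (l 0 * l 2) ^ 2 * (l 2 * l 3) ^ 2 +
        (l 0 * l 3) ^ 2 * (l 2 * l 3) ^ 2) / (l 0 * l 2 * l 3) ^ 2 = l 1 ^ 2 by field_simp; ring,
      Real.sqrt_sq (hl 1)]
  rw [r0, r1, r2, r3]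
  ext i
  fin_cases i <;> simp [h4]

theorem rho_nonneg (c : STUCharges) (i : Fin 4) : 0 ≤ c.rho i := by
  fin_cases i <;> exact Real.sqrt_nonneg _

/-- The canonical form of a `W` black hole. -/
theorem IsW.luEquiv_asdVector {c : STUCharges} (hc : c.IsW) (φ : ℝ) :
    LUEquiv c.state (asdVector ![c.rho 0, c.rho 1, c.rho 2, c.rho 3, 0] φ) := by
  obtain ⟨l, hl, h⟩ := hc.isWClass.exists_asdVector φ
  rwa [← hc.rho_eq hl h]

theorem cons_rho_nonneg (c : STUCharges) (i : Fin 5) :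
    0 ≤ (![c.rho 0, c.rho 1, c.rho 2, c.rho 3, 0] : Fin 5 → ℝ) i := by
  fin_cases i <;> simp [rho_nonneg]

theorem IsW.rho_pos {c : STUCharges} (hc : c.IsW) : 0 < c.rho 0 ∧ 0 < c.rho 2 ∧ 0 < c.rho 3 :=
  (hc.invariants_eq c.cons_rho_nonneg (hc.luEquiv_asdVector 0)).2.1

theorem IsW.h_eq {c : STUCharges} (hc : c.IsW) : c.h₁ = (c.rho 2 * c.rho 3) ^ 2 ∧
    c.h₂ = (c.rho 0 * c.rho 2) ^ 2 ∧ c.h₃ = (c.rho 0 * c.rho 3) ^ 2 ∧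
    c.sumSq = c.rho 0 ^ 2 + c.rho 1 ^ 2 + c.rho 2 ^ 2 + c.rho 3 ^ 2 :=
  (hc.invariants_eq c.cons_rho_nonneg (hc.luEquiv_asdVector 0)).2.2

theorem IsW.sqrtH_eq {c : STUCharges} (hc : c.IsW) :
    c.sqrtH = (c.rho 0 * c.rho 2 * c.rho 3) ^ 2 := by
  obtain ⟨e1, e2, e3, -⟩ := hc.h_eq
  rw [sqrtH, e1, e2, e3, show (c.rho 2 * c.rho 3) ^ 2 * (c.rho 0 * c.rho 2) ^ 2 *
    (c.rho 0 * c.rho 3) ^ 2 = ((c.rho 0 * c.rho 2 * c.rho 3) ^ 2) ^ 2 by ring,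
    Real.sqrt_sq (by positivity)]

theorem IsW.eta_pos {c : STUCharges} (hc : c.IsW) : 0 < c.eta := by
  obtain ⟨p0, -⟩ := hc.rho_pos
  have : 0 < c.sumSq := by rw [hc.h_eq.2.2.2]; positivity
  exact one_div_pos.2 (Real.sqrt_pos.2 this)

theorem IsW.eta_sq_mul_sumSq {c : STUCharges} (hc : c.IsW) : c.eta ^ 2 * c.sumSq = 1 := by
  obtain ⟨p0, -⟩ := hc.rho_pos
  have : 0 < c.sumSq := by rw [hc.h_eq.2.2.2]; positivity
  rw [eta, div_pow, Real.sq_sqrt this.le]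
  field_simp

end STUCharges

/-! ### Normalized states and LU classification -/

theorem smul_asdVector (t : ℝ) (l : Fin 5 → ℝ) (φ : ℝ) :
    (t : ℂ) • asdVector l φ = asdVector (t • l) φ := by
  simp only [asdVector, smul_add, smul_smul, mul_assoc, Pi.smul_apply, smul_eq_mul,
    Complex.ofReal_mul]

namespace STUCharges

theorem IsW.normState_luEquiv_iff {c : STUCharges} (hc : c.IsW) {l : Fin 5 → ℝ} {φ : ℝ}
    (hl : ∀ i, 0 ≤ l i) : LUEquiv c.normState (asdVector l φ) ↔
      l = c.eta • ![c.rho 0, c.rho 1, c.rho 2, c.rho 3, 0] := by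
  have hη := hc.eta_pos
  constructor
  · intro h
    have h' := h.smul ((c.eta⁻¹ : ℝ) : ℂ)
    rw [normState, smul_smul, ← Complex.ofReal_mul, inv_mul_cancel₀ hη.ne', Complex.ofReal_one,
      one_smul, smul_asdVector] at h'
    rw [← hc.rho_eq (l := c.eta⁻¹ • l) (fun i => mul_nonneg (inv_nonneg.2 hη.le) (hl i)) h', smul_smul,
      mul_inv_cancel₀ hη.ne', one_smul]
  · rintro rfl
    rw [← smul_asdVector]
    exact (hc.luEquiv_asdVector φ).smul _

/-- The coefficients are forced by the invariants, while the phase can be chosen at will; this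
governs every statement about decompositions. -/
theorem IsW.isASD_iff {c : STUCharges} (hc : c.IsW) {l : Fin 5 → ℝ} {φ : ℝ} :
    IsASD c.normState l φ ↔ φ ∈ Set.Ico 0 (2 * Real.pi) ∧
      l = c.eta • ![c.rho 0, c.rho 1, c.rho 2, c.rho 3, 0] := by
  constructor
  · rintro ⟨hl, -, hφ, h⟩
    exact ⟨hφ, (hc.normState_luEquiv_iff hl).1 h⟩
  · rintro ⟨hφ, hlr⟩
    have hl : ∀ i, 0 ≤ l i := fun i => by
      rw [hlr]; exact mul_nonneg hc.eta_pos.le (c.cons_rho_nonneg i)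
    refine ⟨hl, ?_, hφ, (hc.normState_luEquiv_iff hl).2 hlr⟩
    rw [hlr, ← hc.eta_sq_mul_sumSq, hc.h_eq.2.2.2]
    simp [Fin.sum_univ_five]
    ring

theorem smul_cons_rho_eq_iff {c c' : STUCharges} {s t : ℝ} :
    s • ![c.rho 0, c.rho 1, c.rho 2, c.rho 3, 0] = t • ![c'.rho 0, c'.rho 1, c'.rho 2, c'.rho 3, 0]
      ↔ ∀ i, s * c.rho i = t * c'.rho i := by
  simp [funext_iff, Fin.forall_fin_succ]

theorem luEquiv_state_iff {c c' : STUCharges} (hc : c.IsW) (hc' : c'.IsW) :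
    LUEquiv c.state c'.state ↔ ∀ i, c.rho i = c'.rho i := by
  constructor
  · intro h
    have := hc.rho_eq c'.cons_rho_nonneg (h.trans (hc'.luEquiv_asdVector 0))
    have h2 := (smul_cons_rho_eq_iff (c := c) (c' := c') (s := 1) (t := 1)).1 (by rw [this])
    simpa using h2
  · intro h
    refine (hc.luEquiv_asdVector 0).trans ?_
    rw [h, h, h, h]
    exact (hc'.luEquiv_asdVector 0).symm

theorem luEquiv_normState_iff {c c' : STUCharges} (hc : c.IsW) (hc' : c'.IsW) :
    LUEquiv c.normState c'.normState ↔ ∀ i, c.eta * c.rho i = c'.eta * c'.rho i := by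
  have nn : ∀ i, 0 ≤ (c'.eta • ![c'.rho 0, c'.rho 1, c'.rho 2, c'.rho 3, 0] : Fin 5 → ℝ) i :=
    fun i => mul_nonneg hc'.eta_pos.le (c'.cons_rho_nonneg i)
  have h' := (hc'.normState_luEquiv_iff (φ := 0) nn).2 rfl
  rw [← smul_cons_rho_eq_iff, eq_comm, ← hc.normState_luEquiv_iff (φ := 0) nn]
  exact ⟨fun h => h.trans h', fun h => h.trans h'.symm⟩

theorem luEquiv_normState_iff_exists_isASD {c c' : STUCharges} (hc : c.IsW) (hc' : c'.IsW) :
    LUEquiv c.normState c'.normState ↔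
      ∃ (l : Fin 5 → ℝ) (φ φ' : ℝ), IsASD c.normState l φ ∧ IsASD c'.normState l φ' := by
  rw [luEquiv_normState_iff hc hc', ← smul_cons_rho_eq_iff]
  simp only [hc.isASD_iff, hc'.isASD_iff]
  have h0 : (0 : ℝ) ∈ Set.Ico 0 (2 * Real.pi) := ⟨le_rfl, by positivity⟩
  constructor
  · exact fun h => ⟨_, 0, 0, ⟨h0, rfl⟩, h0, h⟩
  · rintro ⟨l, φ, φ', ⟨-, h⟩, -, h'⟩
    rw [← h, h']

/-- Real square roots truncate negative radicands, so the formula for `ρ₁²` needs an argument: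
writing `hᵢ` and `Σ` through the `ρᵢ` makes all four identities algebraic. -/
theorem IsW.rho_sq {c : STUCharges} (hc : c.IsW) :
    c.rho 0 ^ 2 = c.sqrtH / c.h₁ ∧
      c.rho 1 ^ 2 = c.sumSq - (c.h₂ * c.h₃ + c.h₂ * c.h₁ + c.h₃ * c.h₁) / c.sqrtH ∧
      c.rho 2 ^ 2 = c.sqrtH / c.h₃ ∧ c.rho 3 ^ 2 = c.sqrtH / c.h₂ := by
  obtain ⟨p0, p2, p3⟩ := hc.rho_pos
  obtain ⟨e1, e2, e3, eN⟩ := hc.h_eq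
  rw [hc.sqrtH_eq, e1, e2, e3, eN]
  refine ⟨?_, ?_, ?_, ?_⟩ <;> field_simp
  ring

theorem IsW.sqrtH_pos {c : STUCharges} (hc : c.IsW) : 0 < c.sqrtH := by
  obtain ⟨p0, p2, p3⟩ := hc.rho_pos
  rw [hc.sqrtH_eq]; positivity

theorem IsW.h_pos {c : STUCharges} (hc : c.IsW) : 0 < c.h₁ ∧ 0 < c.h₂ ∧ 0 < c.h₃ := by
  obtain ⟨p0, p2, p3⟩ := hc.rho_pos
  obtain ⟨e1, e2, e3, -⟩ := hc.h_eq
  rw [e1, e2, e3]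
  exact ⟨by positivity, by positivity, by positivity⟩

theorem IsW.rho_sq_eq_xi_mul {c : STUCharges} (hc : c.IsW) (i : Fin 4) :
    c.rho i ^ 2 = c.xi i * c.sqrtH := by
  obtain ⟨r0, -, r2, r3⟩ := hc.rho_sq
  have hs := hc.sqrtH_pos
  fin_cases i
  · simp [xi, r0]; ring
  · simp [xi]; field_simp
  · simp [xi, r2]; ring
  · simp [xi, r3]; ring

theorem IsW.rho_eq_iff_xi_eq {c : STUCharges} (hc : c.IsW) (i j : Fin 4) :
    c.rho i = c.rho j ↔ c.xi i = c.xi j := by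
  rw [← sq_eq_sq₀ (c.rho_nonneg i) (c.rho_nonneg j), hc.rho_sq_eq_xi_mul, hc.rho_sq_eq_xi_mul,
    mul_left_inj' hc.sqrtH_pos.ne']

end STUCharges

/-! ### The eight equality patterns and their realizations -/

theorem exists_family (x : Fin 4 → ℝ) : ∃ k : Fin 8, family k x := by
  have h7 : (∀ i j : Fin 4, i ≠ j → x i ≠ x j) ↔
      x 0 ≠ x 1 ∧ x 0 ≠ x 2 ∧ x 0 ≠ x 3 ∧ x 1 ≠ x 2 ∧ x 1 ≠ x 3 ∧ x 2 ≠ x 3 := by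
    simp [Fin.forall_fin_succ]
    grind
  by_contra! h
  have f0 := h 0
  have f1 := h 1
  have f2 := h 2
  have f3 := h 3
  have f4 := h 4
  have f5 := h 5
  have f6 := h 6
  have f7 := h 7
  simp only [family, EqThree, EqPair, EqTwoPairs, h7] at f0 f1 f2 f3 f4 f5 f6 f7
  clear h h7
  generalize x 0 = a at *
  generalize x 1 = b at *
  generalize x 2 = c at *
  generalize x 3 = d at *
  grind (splits := 40)

theorem family_unique {x : Fin 4 → ℝ} {k k' : Fin 8} (h : family k x) (h' : family k' x) :
    k = k' := by
  have h7 : (∀ i j : Fin 4, i ≠ j → x i ≠ x j) ↔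
      x 0 ≠ x 1 ∧ x 0 ≠ x 2 ∧ x 0 ≠ x 3 ∧ x 1 ≠ x 2 ∧ x 1 ≠ x 3 ∧ x 2 ≠ x 3 := by
    simp [Fin.forall_fin_succ]
    grind
  wlog hlt : k < k' generalizing k k'
  · rcases lt_trichotomy k k' with h1 | h1 | h1
    · exact this h h' h1
    · exact h1
    · exact (this h' h h1).symm
  exfalso
  fin_cases k <;> fin_cases k' <;> first
    | exact absurd hlt (by decide)
    | (simp only [family, EqThree, EqPair, EqTwoPairs, h7] at h h'
       clear hlt h7
       grind)

theorem existsUnique_family (x : Fin 4 → ℝ) : ∃! k : Fin 8, family k x := by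
  obtain ⟨k, hk⟩ := exists_family x
  exact ⟨k, hk, fun _ h => family_unique h hk⟩

/-- Homogeneity of the patterns lets LU equivalence of normalized states, which only compares the `η
ρᵢ`, preserve the family. -/
theorem family_smul_iff {t : ℝ} (ht : t ≠ 0) (k : Fin 8) (x : Fin 4 → ℝ) :
    family k (t • x) ↔ family k x := by
  fin_cases k <;> simp [family, EqThree, EqPair, EqTwoPairs, ht]

/-- Vectors `a|000⟩ + b|100⟩ + c|101⟩ + d|110⟩` with `acd ≠ 0` have the class of `W`. -/
theorem sloccEquiv_wState_of_ne_zero {a b c d : ℂ} (ha : a ≠ 0) (hc : c ≠ 0) (hd : d ≠ 0) :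
    SLOCCEquiv wState (a • ket 0 0 0 + b • ket 1 0 0 + c • ket 1 0 1 + d • ket 1 1 0) := by
  have h3 : ((√3 : ℝ) : ℂ) ≠ 0 := by simp
  -- The first operator sends `|0⟩` to `√3|1⟩` and `|1⟩` to `√3(a|0⟩ + b|1⟩)`; thus 100 yields the
  -- `a` and `b` terms, 010 the `d` term and 001 the `c` term.
  refine ⟨!![0, √3 * a; √3, √3 * b], !![1, 0; 0, d], !![1, 0; 0, c], ?_, ?_, ?_, ?_⟩
  · simp [Matrix.isUnit_iff_isUnit_det, Matrix.det_fin_two, ha]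
  · simp [Matrix.isUnit_iff_isUnit_det, Matrix.det_fin_two, hd]
  · simp [Matrix.isUnit_iff_isUnit_det, Matrix.det_fin_two, hc]
  ext ⟨i, j, k⟩
  rw [localAct_apply]
  fin_cases i <;> fin_cases j <;> fin_cases k <;>
    simp [wState, ket, Fin.sum_univ_two, Pi.single_apply] <;> field_simp

namespace STUCharges

/-- The charges of the black hole with state `a|000⟩ + b|100⟩ + c|101⟩ + d|110⟩`. -/
def ofCoeff (a b c d : ℕ) : STUCharges where
  p := ![a, 0, 0, -b]
  q := ![0, d, c, 0]

theorem state_ofCoeff (a b c d : ℕ) : (ofCoeff a b c d).state =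
    (a : ℂ) • ket 0 0 0 + (b : ℂ) • ket 1 0 0 + (c : ℂ) • ket 1 0 1 + (d : ℂ) • ket 1 1 0 := by
  simp [state, ofCoeff]

theorem isW_ofCoeff {a c d : ℕ} (b : ℕ) (ha : a ≠ 0) (hc : c ≠ 0) (hd : d ≠ 0) :
    (ofCoeff a b c d).IsW := by
  rw [IsW, state_ofCoeff]
  exact sloccEquiv_wState_of_ne_zero (by exact_mod_cast ha) (by exact_mod_cast hc)
    (by exact_mod_cast hd)

/-- The state is already canonical with phase 0, so uniqueness of the coefficients reads off the
`ρᵢ`. -/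
theorem rho_ofCoeff {a c d : ℕ} (b : ℕ) (ha : a ≠ 0) (hc : c ≠ 0) (hd : d ≠ 0) :
    (ofCoeff a b c d).rho = ![(a : ℝ), b, c, d] := by
  have h : (ofCoeff a b c d).state = asdVector ![(a : ℝ), b, c, d, 0] 0 := by
    simp [state_ofCoeff, asdVector]
  have := (isW_ofCoeff b ha hc hd).rho_eq (l := ![(a : ℝ), b, c, d, 0]) (φ := 0)
    (fun i => by fin_cases i <;> simp) (h ▸ LUEquiv.refl _)
  ext i
  fin_cases i
  · exact (congrFun this 0).symm
  · exact (congrFun this 1).symm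
  · exact (congrFun this 2).symm
  · exact (congrFun this 3).symm

end STUCharges

theorem exists_isW_family (k : Fin 8) : ∃ c : STUCharges, c.IsW ∧ family k c.rho := by
  have key (a b c d : ℕ) (ha : a ≠ 0) (hc : c ≠ 0) (hd : d ≠ 0)
      (h : family k ![(a : ℝ), b, c, d]) : ∃ c : STUCharges, c.IsW ∧ family k c.rho :=
    ⟨_, STUCharges.isW_ofCoeff b ha hc hd, by rwa [STUCharges.rho_ofCoeff b ha hc hd]⟩
  fin_cases k
  · exact key 1 0 1 1 (by simp) (by simp) (by simp) (by simp [family])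
  · exact key 1 0 1 2 (by simp) (by simp) (by simp) (by simp [family])
  · exact key 1 0 2 3 (by simp) (by simp) (by simp) (by simp [family])
  · exact key 1 1 1 1 (by simp) (by simp) (by simp) (by simp [family])
  · exact key 1 1 1 2 (by simp) (by simp) (by simp) (by simp [family, EqThree])
  · exact key 1 1 2 3 (by simp) (by simp) (by simp) (by simp [family, EqPair])
  · exact key 1 1 2 2 (by simp) (by simp) (by simp) (by simp [family, EqTwoPairs])
  · exact key 1 2 3 4 (by simp) (by simp) (by simp) (by norm_num [family, Fin.forall_fin_succ])

theorem family_rho_congr {c c' : STUCharges} (hc : c.IsW) (hc' : c'.IsW)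
    (h : LUEquiv c.state c'.state ∨ LUEquiv c.normState c'.normState) (k : Fin 8) :
    family k c.rho ↔ family k c'.rho := by
  rcases h with h | h
  · rw [funext ((STUCharges.luEquiv_state_iff hc hc').1 h)]
  · have e : c.eta • c.rho = c'.eta • c'.rho :=
      funext ((STUCharges.luEquiv_normState_iff hc hc').1 h)
    rw [← family_smul_iff hc.eta_pos.ne', e, family_smul_iff hc'.eta_pos.ne']

theorem lemma3 :
    -- the decomposition coefficients of a W black hole
    (∀ c : STUCharges, c.IsW →
      (c.h₁ * c.h₂ * c.h₃ ≠ 0 ∧ c.rho 0 * c.rho 2 * c.rho 3 ≠ 0) ∧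
      (c.rho 0 ^ 2 = √(c.h₁ * c.h₂ * c.h₃) / c.h₁ ∧
        c.rho 1 ^ 2 = c.sumSq - (c.h₂ * c.h₃ + c.h₂ * c.h₁ + c.h₃ * c.h₁)
          / √(c.h₁ * c.h₂ * c.h₃) ∧
        c.rho 2 ^ 2 = √(c.h₁ * c.h₂ * c.h₃) / c.h₃ ∧
        c.rho 3 ^ 2 = √(c.h₁ * c.h₂ * c.h₃) / c.h₂ ∧
        ∀ i, c.rho i ^ 2 = c.xi i * √(c.h₁ * c.h₂ * c.h₃)) ∧
      -- the normalized state has decompositions, with phase factor `1` and with phase factor `-1`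
      (∀ φ : ℝ, φ = 0 ∨ φ = Real.pi → ∃ l, IsASD c.normState l φ) ∧
      -- and every decomposition of it has these coefficients
      (∀ (l : Fin 5 → ℝ) (φ : ℝ), IsASD c.normState l φ →
        l 0 ^ 2 = c.eta ^ 2 * c.rho 0 ^ 2 ∧ l 1 ^ 2 = c.eta ^ 2 * c.rho 1 ^ 2 ∧
        l 2 ^ 2 = c.eta ^ 2 * c.rho 2 ^ 2 ∧ l 3 ^ 2 = c.eta ^ 2 * c.rho 3 ^ 2 ∧ l 4 = 0)) ∧
    -- LU equivalence of W black holes, for the states `|ω⟩` and for the normalized states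
    (∀ c c' : STUCharges, c.IsW → c'.IsW →
      (LUEquiv c.state c'.state ↔ ∀ i, c.rho i = c'.rho i) ∧
      (LUEquiv c.normState c'.normState ↔ ∀ i, c.eta * c.rho i = c'.eta * c'.rho i) ∧
      (LUEquiv c.normState c'.normState ↔
        ∃ (l : Fin 5 → ℝ) (φ φ' : ℝ), IsASD c.normState l φ ∧ IsASD c'.normState l φ')) ∧
    -- the eight families partition the W black holes into unions of LU classes
    (∀ c : STUCharges, c.IsW → ∃! k : Fin 8, family k c.rho) ∧
    (∀ k : Fin 8, ∃ c : STUCharges, c.IsW ∧ family k c.rho) ∧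
    (∀ c c' : STUCharges, c.IsW → c'.IsW →
      LUEquiv c.state c'.state ∨ LUEquiv c.normState c'.normState →
      ∀ k : Fin 8, family k c.rho ↔ family k c'.rho) ∧
    -- the families in terms of the `hᵢ` for `ρ₁ = 0`, and in terms of the `ξᵢ` for `ρ₁ ≠ 0`
    (∀ c : STUCharges, c.IsW → c.rho 1 = 0 →
      (c.rho 0 = c.rho 2 ↔ c.h₁ = c.h₃) ∧ (c.rho 0 = c.rho 3 ↔ c.h₁ = c.h₂) ∧
      (c.rho 2 = c.rho 3 ↔ c.h₃ = c.h₂)) ∧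
    (∀ c : STUCharges, c.IsW → c.rho 1 ≠ 0 →
      ∀ i j : Fin 4, c.rho i = c.rho j ↔ c.xi i = c.xi j) := by
  refine ⟨fun c hc => ?_, fun c c' hc hc' => ⟨STUCharges.luEquiv_state_iff hc hc',
    STUCharges.luEquiv_normState_iff hc hc',
    STUCharges.luEquiv_normState_iff_exists_isASD hc hc'⟩, fun c _ => existsUnique_family _,
    exists_isW_family, fun c c' hc hc' => family_rho_congr hc hc', fun c hc _ => ?_,
    fun c hc _ => hc.rho_eq_iff_xi_eq⟩
  · obtain ⟨p0, p2, p3⟩ := hc.rho_pos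
    obtain ⟨q1, q2, q3⟩ := hc.h_pos
    obtain ⟨r0, r1, r2, r3⟩ := hc.rho_sq
    refine ⟨⟨by positivity, by positivity⟩, ⟨r0, r1, r2, r3, hc.rho_sq_eq_xi_mul⟩,
      fun φ hφ => ⟨_, hc.isASD_iff.2 ⟨?_, rfl⟩⟩, fun l φ h => ?_⟩
    · have := Real.pi_pos
      rcases hφ with rfl | rfl
      · exact ⟨le_rfl, by positivity⟩
      · exact ⟨by positivity, by linarith⟩
    · rw [(hc.isASD_iff.1 h).2]
      simp [mul_pow]
  -- Here `ξ₀`, `ξ₂`, `ξ₃` are the reciprocals of `h₁`, `h₃`, `h₂`, and inversion is injective.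
  · refine ⟨(hc.rho_eq_iff_xi_eq 0 2).trans ?_, (hc.rho_eq_iff_xi_eq 0 3).trans ?_,
      (hc.rho_eq_iff_xi_eq 2 3).trans ?_⟩ <;> simp [STUCharges.xi]
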